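/- All functions are defined on $\mathbb{R}^3$ with Lebesgue measure. Let $L^2=L^2(\mathbb{R}^3;\mathbb{R})$, and let $\mathcal{L}^2=L^2(\mathbb{R}^3;\mathcal{S}^{3\times 3})$ be the space of square integrable fields of real symmetric $3\times 3$ matrices, with the pairing $\langle S,M\rangle=\int_{\mathbb{R}^3}\sum_{i,j=1}^3 S_{ij}(x)M_{ij}(x)\,dx$. For $f\in L^2$ let $(-\Delta)^{-1/2}f$ be the tempered distribution whose Fourier transform is the locally integrable function $(2\pi|\xi|)^{-1}\hat f(\xi)$, where $\hat f(\xi)=\int e^{-2\pi i x\cdot\xi}f(x)\,dx$ (extended to $L^2$), and apply $(-\Delta)^{-1/2}$ to vector fields componentwise. Let $$\mathbf{L}^2_{df}=\left\{u\in L^2(\mathbb{R}^3;\mathbb{R}^3):\ \nabla\cdot(-\Delta)^{-1/2}u=0\right\},\qquad \mathcal{L}^2_{st}=\left\{\nabla_{sym}(-\Delta)^{-1/2}u:\ u\in\mathbf{L}^2_{df}\right\}\subset\mathcal{L}^2,$$ where derivatives are distributional and $(\nabla_{sym}v)_{ij}=\tfrac12(\partial_i v_j+\partial_j v_i)$. Elements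 of $\mathcal{L}^2_{st}$ are called strain matrices. Then for every $S\in\mathcal{L}^2$, one has $S\in\mathcal{L}^2_{st}$ if and only if the following three conditions all hold: 1. $\langle S,\operatorname{Hess}(f)\rangle=0$ for all $f\in C_c^\infty(\mathbb{R}^3)$; 2. $\langle S,g I_3\rangle=0$ for all $g\in C_c^\infty(\mathbb{R}^3)$; 3. $\langle S,M\rangle=0$ for all $M\in C_c^\infty(\mathbb{R}^3;\mathcal{S}^{3\times 3})$ with $\operatorname{tr}(M)=0$ and $\operatorname{div}(M)=0$, where $\operatorname{div}(M)_j=\sum_{i=1}^3\partial_i M_{ij}$. -/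

import Mathlib

open MeasureTheory SchwartzMap FourierTransform LineDeriv

open scoped ContDiff

noncomputable section

/-- The Euclidean space `ℝ³`. -/
abbrev R3 : Type := EuclideanSpace ℝ (Fin 3)

/-- The standard basis vectors of `ℝ³`. -/
def stdVec (i : Fin 3) : R3 := EuclideanSpace.single i 1

/-- Real square integrable scalars on `ℝ³` with Lebesgue measure. -/
abbrev L2 : Type := Lp ℝ 2 (volume : Measure R3)

/-- Complex square integrable scalars on `ℝ³`. -/
abbrev L2C : Type := Lp ℂ 2 (volume : Measure R3)

/-- A real square integrable scalar, regarded as a complex one. -/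
def L2.toComplex (f : L2) : L2C := Complex.ofRealCLM.compLp f

/-- The space `L²(ℝ³; 𝓢^{3×3})` of square integrable symmetric matrices: matrices `S` with
entries in `L²(ℝ³; ℝ)` such that `S i j = S j i`. -/
def L2Sym : Set (Matrix (Fin 3) (Fin 3) L2) := {S | S.IsSymm}

/-! ### The operator `(-Δ)^{-1/2}` -/

/-- The radial function `1 / ((1 + |ξ|)² 2π|ξ|)` is square integrable on `ℝ³`. -/
lemma memLp_weight :
    MemLp (fun ξ : R3 => ((1 + ‖ξ‖) ^ 2)⁻¹ * (2 * Real.pi * ‖ξ‖)⁻¹) 2 volume := by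
  rw [memLp_two_iff_integrable_sq]
  · have key := (integrable_fun_norm_addHaar (E := R3) (volume : Measure R3)
      (f := fun r : ℝ => (((1 + r) ^ 2)⁻¹ * (2 * Real.pi * r)⁻¹) ^ 2)).2
    refine key ?_
    have hdim : Module.finrank ℝ R3 = 3 := by simp
    rw [hdim]
    have hint : Integrable (fun r : ℝ => ((2 * Real.pi)⁻¹ ^ 2) * (1 + r ^ 2)⁻¹) :=
      integrable_inv_one_add_sq.const_mul _
    refine Integrable.mono' hint.integrableOn
      (by apply Measurable.aestronglyMeasurable; fun_prop) ?_
    filter_upwards [ae_restrict_mem measurableSet_Ioi] with r hr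
    have hr : 0 < r := hr
    have hpi := Real.pi_pos
    have e : r ^ (3 - 1) • (((1 + r) ^ 2)⁻¹ * (2 * Real.pi * r)⁻¹) ^ 2
        = ((2 * Real.pi)⁻¹ ^ 2) * ((1 + r) ^ 4)⁻¹ := by
      simp only [smul_eq_mul, Nat.add_one_sub_one]
      field_simp
    rw [e, Real.norm_of_nonneg (by positivity)]
    gcongr
    nlinarith [sq_nonneg r, pow_pos hr 3, pow_pos hr 4]
  · apply Measurable.aestronglyMeasurable
    fun_prop

/-- Pairing of a Schwartz function with `(2π|ξ|)⁻¹ h(ξ)` for a square integrable `h`: the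
integrand is dominated by a Schwartz seminorm times a fixed integrable function. -/
lemma norm_le_weight (φ : 𝓢(R3, ℂ)) (h : L2C) (ξ : R3) :
    ‖φ ξ * (((2 * Real.pi * ‖ξ‖)⁻¹ : ℝ) * h ξ)‖ ≤
      (2 ^ 2 * (Finset.Iic (2, 0)).sup (fun m => SchwartzMap.seminorm ℂ m.1 m.2) φ) *
        ((((1 + ‖ξ‖) ^ 2)⁻¹ * (2 * Real.pi * ‖ξ‖)⁻¹) * ‖h ξ‖) := by
  have h1 := SchwartzMap.one_add_le_sup_seminorm_apply (𝕜 := ℂ) (m := (2, 0)) (k := 2) (n := 0)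
    le_rfl le_rfl φ ξ
  rw [norm_iteratedFDeriv_zero] at h1
  have hpi := Real.pi_pos
  have hw : 0 ≤ (2 * Real.pi * ‖ξ‖)⁻¹ := by positivity
  rw [norm_mul, norm_mul, Complex.norm_real, Real.norm_of_nonneg hw]
  have h2 : ‖φ ξ‖ ≤ (2 ^ 2 * (Finset.Iic (2, 0)).sup
      (fun m => SchwartzMap.seminorm ℂ m.1 m.2) φ) * ((1 + ‖ξ‖) ^ 2)⁻¹ := by
    rw [← div_eq_mul_inv, le_div_iff₀ (by positivity), mul_comm]
    exact h1
  calc _ ≤ ((2 ^ 2 * (Finset.Iic (2, 0)).sup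
      (fun m => SchwartzMap.seminorm ℂ m.1 m.2) φ) * ((1 + ‖ξ‖) ^ 2)⁻¹) *
        ((2 * Real.pi * ‖ξ‖)⁻¹ * ‖h ξ‖) := by gcongr
    _ = _ := by ring

lemma integrable_weight_mul (h : L2C) :
    Integrable (fun ξ : R3 => (((1 + ‖ξ‖) ^ 2)⁻¹ * (2 * Real.pi * ‖ξ‖)⁻¹) * ‖h ξ‖) :=
  MemLp.integrable_mul memLp_weight (Lp.memLp h).norm

lemma integrable_pairing (φ : 𝓢(R3, ℂ)) (h : L2C) :
    Integrable (fun ξ : R3 => φ ξ * (((2 * Real.pi * ‖ξ‖)⁻¹ : ℝ) * h ξ)) := by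
  refine Integrable.mono' ((integrable_weight_mul h).const_mul _) ?_
    (Filter.Eventually.of_forall (norm_le_weight φ h))
  refine φ.continuous.aestronglyMeasurable.mul (AEStronglyMeasurable.mul ?_
    (Lp.aestronglyMeasurable h))
  apply Measurable.aestronglyMeasurable
  fun_prop

/-- For `h ∈ L²`, the locally integrable function `(2π|ξ|)⁻¹ h(ξ)` as a tempered distribution,
`φ ↦ ∫ φ(ξ) (2π|ξ|)⁻¹ h(ξ) dξ`. -/
def invNormMul (h : L2C) : 𝓢'(R3, ℂ) :=
  ContinuousLinearMap.toPointwiseConvergenceCLM _ _ _ _ <|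
    SchwartzMap.mkCLMtoNormedSpace (𝕜 := ℂ) (σ := RingHom.id ℂ)
      (fun φ : 𝓢(R3, ℂ) => ∫ ξ : R3, φ ξ * (((2 * Real.pi * ‖ξ‖)⁻¹ : ℝ) * h ξ))
      (fun φ ψ => by
        rw [← integral_add (integrable_pairing φ h) (integrable_pairing ψ h)]
        simp only [_root_.add_apply, add_mul])
      (fun a φ => by
        simp only [_root_.smul_apply, smul_eq_mul, RingHom.id_apply, mul_assoc]
        exact integral_const_mul a _)
      ⟨Finset.Iic (2, 0), 2 ^ 2 *
        ∫ ξ : R3, (((1 + ‖ξ‖) ^ 2)⁻¹ * (2 * Real.pi * ‖ξ‖)⁻¹) * ‖h ξ‖, by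
        have := Real.pi_pos
        positivity, fun φ => by
        refine (norm_integral_le_of_norm_le ((integrable_weight_mul h).const_mul _)
          (Filter.Eventually.of_forall (norm_le_weight φ h))).trans ?_
        rw [integral_const_mul]
        exact le_of_eq (mul_right_comm _ _ _)⟩

lemma invNormMul_apply (h : L2C) (φ : 𝓢(R3, ℂ)) :
    invNormMul h φ = ∫ ξ : R3, φ ξ * (((2 * Real.pi * ‖ξ‖)⁻¹ : ℝ) * h ξ) := rfl

/-- The tempered distribution `(-Δ)^{-1/2} f` for `f ∈ L²(ℝ³)`: its Fourier transform is
`((2π|ξ|)²)^{-1/2}` times that of `f`, where `𝓕 f (ξ) = ∫ e^{-2πi x·ξ} f(x) dx`. -/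
def invSqrtLaplacian (f : L2) : 𝓢'(R3, ℂ) := 𝓕⁻ (invNormMul (𝓕 f.toComplex))

/-! ### Divergence free vector fields and strain matrices -/

/-- The space of divergence free fields, `{u ∈ L²(ℝ³; ℝ³) : ∇ · (-Δ)^{-1/2} u = 0}`, the
divergence being that of tempered distributions. -/
def L2df : Set (Fin 3 → L2) :=
  {u | ∑ i, ∂_{stdVec i} (invSqrtLaplacian (u i)) = 0}

/-- Entry `(i, j)` of the symmetric gradient `½ (∂ᵢ vⱼ + ∂ⱼ vᵢ)` of a vector of tempered
distributions. -/
def symGrad (v : Fin 3 → 𝓢'(R3, ℂ)) (i j : Fin 3) : 𝓢'(R3, ℂ) :=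
  (1 / 2 : ℂ) • (∂_{stdVec i} (v j) + ∂_{stdVec j} (v i))

/-- The space of strain matrices, `{∇_sym (-Δ)^{-1/2} u : u ∈ L2df}`; the equality
`S = ∇_sym (-Δ)^{-1/2} u` is equality of tempered distributions, entry by entry. -/
def L2st : Set (Matrix (Fin 3) (Fin 3) L2) :=
  {S | S ∈ L2Sym ∧ ∃ u ∈ L2df, ∀ i j,
    Lp.toTemperedDistribution (S i j).toComplex = symGrad (fun k => invSqrtLaplacian (u k)) i j}

/-! ### Test fields -/

/-- The classical partial derivative `∂ᵢ f`. -/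
def partialD (i : Fin 3) (f : R3 → ℝ) (x : R3) : ℝ := fderiv ℝ f x (stdVec i)

/-- The Hessian matrix of a function. -/
def hess (f : R3 → ℝ) (x : R3) : Matrix (Fin 3) (Fin 3) ℝ :=
  Matrix.of fun i j => partialD i (partialD j f) x

/-- The divergence of a matrix field, `div(M)ⱼ = ∑ᵢ ∂ᵢ Mᵢⱼ`. -/
def matDiv (M : R3 → Matrix (Fin 3) (Fin 3) ℝ) (x : R3) (j : Fin 3) : ℝ :=
  ∑ i, partialD i (fun y => M y i j) x

/-- `f ∈ C_c^∞(ℝ³)`. -/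
def IsTestFun (f : R3 → ℝ) : Prop := ContDiff ℝ ∞ f ∧ HasCompactSupport f

/-- `M ∈ C_c^∞(ℝ³; 𝓢^{3×3})`. -/
def IsSymTestField (M : R3 → Matrix (Fin 3) (Fin 3) ℝ) : Prop :=
  (∀ x, (M x).IsSymm) ∧ ∀ i j, IsTestFun (fun x => M x i j)

/-- The pairing `⟨S, M⟩ = ∫ ∑ᵢⱼ Sᵢⱼ(x) Mᵢⱼ(x) dx`. -/
def l2Pairing (S : Matrix (Fin 3) (Fin 3) L2) (M : R3 → Matrix (Fin 3) (Fin 3) ℝ) : ℝ :=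
  ∫ x : R3, ∑ i, ∑ j, S i j x * M x i j

end

/-! Fix a frequency ξ ≠ 0 and put d = -2πiξ. The six-dimensional space of symmetric matrices splits
into the span of d ⊗ d and I, the plane of trace free T with T d = 0, and the shears d ⊗ q + q ⊗ d
with q ⟂ d. Strain matrices are the fields whose Fourier transform is a shear almost everywhere. The
three conditions remove the other components: Hessians test against d ⊗ d, scalar fields against I,
trace free divergence free fields against the T.

Necessity is integration by parts for distributions (`sum_symGrad_hess_eq_zero`,
`sum_symGrad_diag_eq_zero`, `sum_symGrad_apply_eq_zero`).

For sufficiency, spanning matrices T are chosen polynomial in d (`transverseTraceFree`), so that the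
test fields m(D)φ they define keep compact support. Density of test functions in the Schwartz space
then turns each condition into a pointwise linear relation on the Fourier transform of S
(`ae_sum_symbol_mul_fourier_eq_zero`). The identity `sum_mul_self_mul_eq_of_orthogonal` recovers
that matrix from its product with d, which up to a factor is the transform of u = -2 div (-Δ)^{-1/2}
S. This u is square integrable, and real by Hermitian symmetry (`exists_velocity`). -/

noncomputable section

/-! ### Density of test functions in the Schwartz space -/

section Density

variable {E : Type*} [NormedAddCommGroup E] [NormedSpace ℝ E]

/-- The dilations `x ↦ χ (a x) - 1`, `0 ≤ a ≤ 1`, of a compactly supported smooth `χ` have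
uniformly bounded derivatives of each order. -/
lemma exists_bound_iteratedFDeriv_cutoff {χ : E → ℂ} (hχ : ContDiff ℝ ∞ χ)
    (hc : HasCompactSupport χ) (j : ℕ) :
    ∃ C, 0 ≤ C ∧ ∀ a : ℝ, 0 ≤ a → a ≤ 1 → ∀ x,
      ‖iteratedFDeriv ℝ j (fun y => χ (a • y) - 1) x‖ ≤ C := by
  obtain ⟨C, hC⟩ := (hc.iteratedFDeriv (𝕜 := ℝ) j).exists_bound_of_continuous
    ((hχ.of_le (mod_cast le_top)).continuous_iteratedFDeriv')
  have hC0 : 0 ≤ C := (norm_nonneg _).trans (hC 0)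
  -- The chain rule factor a ^ j is at most 1, so `C` bounds the dilated cutoff; the extra 1 pays
  -- for the subtracted constant when j = 0.
  refine ⟨C + 1, by positivity, fun a ha0 ha1 x => ?_⟩
  have hs : ContDiff ℝ ∞ (fun y : E => χ (a • y)) := hχ.comp (contDiff_const_smul a)
  have h1 : iteratedFDeriv ℝ j (fun y => χ (a • y) - 1) x =
      iteratedFDeriv ℝ j (fun y => χ (a • y)) x - iteratedFDeriv ℝ j (fun _ => (1 : ℂ)) x :=
    iteratedFDeriv_sub_apply (hs.contDiffAt.of_le (mod_cast le_top)) contDiffAt_const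
  have h2 : iteratedFDeriv ℝ j (fun y => χ (a • y)) x = a ^ j • iteratedFDeriv ℝ j χ (a • x) := by
    rw [iteratedFDeriv_comp_const_smul a (i := j) (hχ.of_le (mod_cast le_top))]
  have h3 : ‖iteratedFDeriv ℝ j (fun _ : E => (1 : ℂ)) x‖ ≤ 1 := by
    rcases Nat.eq_zero_or_pos j with rfl | hj
    · simp
    · simp [iteratedFDeriv_const_of_ne hj.ne']
  rw [h1, h2]
  refine (norm_sub_le _ _).trans (add_le_add ?_ h3)
  rw [norm_smul, norm_pow, Real.norm_of_nonneg ha0]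
  exact (mul_le_of_le_one_left (norm_nonneg _) (pow_le_one₀ ha0 ha1)).trans (hC _)

/-- A Schwartz function is the limit of its cutoffs `χ (x / n) φ (x)`. -/
lemma tendsto_cutoff {χ : E → ℂ} (hχ : ContDiff ℝ ∞ χ) (hc : HasCompactSupport χ)
    (h1 : ∀ x, ‖x‖ ≤ 1 → χ x = 1) (φ : 𝓢(E, ℂ)) :
    Filter.Tendsto (fun n : ℕ => smulLeftCLM ℂ (fun x => χ (((n : ℝ) + 1)⁻¹ • x)) φ)
      Filter.atTop (nhds φ) := by
  rw [(schwartz_withSeminorms ℝ E ℂ).tendsto_nhds]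
  rintro ⟨k, l⟩ ε hε
  choose C hC0 hC using fun j => exists_bound_iteratedFDeriv_cutoff hχ hc j
  -- The Leibniz bound uses the weight k + 1 instead of k: the spare power of ‖x‖ yields the decay 1
  -- / (n + 1).
  set B : ℝ := ∑ j ∈ Finset.range (l + 1), (l.choose j : ℝ) * C j *
    SchwartzMap.seminorm ℝ (k + 1) (l - j) φ with hB
  have hB0 : 0 ≤ B := Finset.sum_nonneg fun j _ => by
    have := hC0 j
    have := apply_nonneg (SchwartzMap.seminorm ℝ (k + 1) (l - j)) φ
    positivity
  have hlim : Filter.Tendsto (fun n : ℕ => B * ((n : ℝ) + 1)⁻¹) Filter.atTop (nhds 0) := by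
    have := (tendsto_one_div_add_atTop_nhds_zero_nat (𝕜 := ℝ)).const_mul B
    simpa [one_div] using this
  filter_upwards [hlim.eventually (gt_mem_nhds hε)] with n hn
  refine lt_of_le_of_lt ?_ hn
  have hn0 : (0 : ℝ) < (n : ℝ) + 1 := by positivity
  have hs : ContDiff ℝ ∞ (fun y : E => χ (((n : ℝ) + 1)⁻¹ • y)) :=
    hχ.comp (contDiff_const_smul _)
  have hcs : HasCompactSupport (fun y : E => χ (((n : ℝ) + 1)⁻¹ • y)) :=
    hc.comp_smul (inv_ne_zero hn0.ne')
  refine SchwartzMap.seminorm_le_bound ℝ k l _ (by positivity) fun x => ?_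
  have hfun : ((smulLeftCLM ℂ (fun x => χ (((n : ℝ) + 1)⁻¹ • x)) φ - φ : 𝓢(E, ℂ)) : E → ℂ) =
      fun y => (χ (((n : ℝ) + 1)⁻¹ • y) - 1) * φ y := by
    ext y
    have := smulLeftCLM_apply_apply (F := ℂ) (hcs.hasTemperateGrowth hs) φ y
    simp [this, sub_mul]
  rw [hfun]
  rcases lt_or_ge ‖x‖ ((n : ℝ) + 1) with hx | hx
  -- Strictly inside the ball the cutoff is 1 on a neighbourhood of x, so all derivatives of the
  -- difference vanish there.
  · have hev : (fun y => (χ (((n : ℝ) + 1)⁻¹ • y) - 1) * φ y) =ᶠ[nhds x] fun _ => (0 : ℂ) := by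
      filter_upwards [(continuous_norm.tendsto x).eventually (gt_mem_nhds hx)] with y hy
      have : ‖((n : ℝ) + 1)⁻¹ • y‖ ≤ 1 := by
        rw [norm_smul, norm_inv, Real.norm_of_nonneg hn0.le, inv_mul_le_iff₀ hn0]
        simpa using hy.le
      simp [h1 _ this]
    rw [(hev.iteratedFDeriv ℝ l).eq_of_nhds]
    have : iteratedFDeriv ℝ l (fun _ : E => (0 : ℂ)) x = 0 := by
      simp
    rw [this]
    simp only [norm_zero, mul_zero]
    positivity
  · have hle := norm_iteratedFDeriv_mul_le (𝕜 := ℝ) (N := ∞) (n := l)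
      (f := fun y => χ (((n : ℝ) + 1)⁻¹ • y) - 1) (g := φ)
      (hs.sub contDiff_const) (φ.smooth ⊤) x (mod_cast le_top)
    have ha1 : ((n : ℝ) + 1)⁻¹ ≤ 1 := inv_le_one_of_one_le₀ (by
      have : (0 : ℝ) ≤ n := n.cast_nonneg
      linarith)
    have hxk : ‖x‖ ^ k ≤ ‖x‖ ^ (k + 1) * ((n : ℝ) + 1)⁻¹ := by
      rw [← div_eq_mul_inv, le_div_iff₀ hn0, pow_succ]
      gcongr
    calc ‖x‖ ^ k * ‖iteratedFDeriv ℝ l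
          (fun y => (χ (((n : ℝ) + 1)⁻¹ • y) - 1) * φ y) x‖
        ≤ (‖x‖ ^ (k + 1) * ((n : ℝ) + 1)⁻¹) * ∑ j ∈ Finset.range (l + 1), (l.choose j : ℝ) *
          ‖iteratedFDeriv ℝ j (fun y => χ (((n : ℝ) + 1)⁻¹ • y) - 1) x‖ *
          ‖iteratedFDeriv ℝ (l - j) φ x‖ := by gcongr
      _ = (∑ j ∈ Finset.range (l + 1), (l.choose j : ℝ) *
          ‖iteratedFDeriv ℝ j (fun y => χ (((n : ℝ) + 1)⁻¹ • y) - 1) x‖ *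
          (‖x‖ ^ (k + 1) * ‖iteratedFDeriv ℝ (l - j) φ x‖)) * ((n : ℝ) + 1)⁻¹ := by
        rw [Finset.mul_sum, Finset.sum_mul]
        exact Finset.sum_congr rfl fun j _ => by ring
      _ ≤ B * ((n : ℝ) + 1)⁻¹ := by
        refine mul_le_mul_of_nonneg_right (Finset.sum_le_sum fun j _ => ?_) (by positivity)
        have := hC0 j
        gcongr
        · exact hC j _ (by positivity) ha1 x
        · exact le_seminorm ℝ (k + 1) (l - j) φ x

/-- Compactly supported smooth functions are dense in the Schwartz space. -/
lemma dense_hasCompactSupport [FiniteDimensional ℝ E] :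
    Dense {φ : 𝓢(E, ℂ) | HasCompactSupport φ} := by
  intro φ
  let b : ContDiffBump (0 : E) := ⟨1, 2, one_pos, one_lt_two⟩
  have hχ : ContDiff ℝ ∞ (fun x => (b x : ℂ)) := Complex.ofRealCLM.contDiff.comp b.contDiff
  have hc : HasCompactSupport (fun x => (b x : ℂ)) :=
    b.hasCompactSupport.comp_left (g := ((↑) : ℝ → ℂ)) Complex.ofReal_zero
  have h1 : ∀ x, ‖x‖ ≤ 1 → (b x : ℂ) = 1 := fun x hx => by
    rw [b.one_of_mem_closedBall (by simpa using hx), Complex.ofReal_one]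
  refine mem_closure_of_tendsto (tendsto_cutoff hχ hc h1 φ) (Filter.Eventually.of_forall fun n => ?_)
  have hn0 : (0 : ℝ) < (n : ℝ) + 1 := by positivity
  have hcs : HasCompactSupport (fun y : E => (b (((n : ℝ) + 1)⁻¹ • y) : ℂ)) :=
    hc.comp_smul (inv_ne_zero hn0.ne')
  exact hcs.of_isClosed_subset (isClosed_tsupport _)
    ((tsupport_smulLeftCLM_subset _ _).trans Set.inter_subset_right)

end Density

/-! ### Test functions as Schwartz functions -/

lemma IsTestFun.contDiff_ofReal {f : R3 → ℝ} (hf : IsTestFun f) :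
    ContDiff ℝ ∞ (fun x => (f x : ℂ)) :=
  Complex.ofRealCLM.contDiff.comp hf.1

lemma IsTestFun.hasCompactSupport_ofReal {f : R3 → ℝ} (hf : IsTestFun f) :
    HasCompactSupport (fun x => (f x : ℂ)) :=
  hf.2.comp_left (g := ((↑) : ℝ → ℂ)) Complex.ofReal_zero

/-- A real test function as a complex Schwartz function. -/
def IsTestFun.toSchwartz {f : R3 → ℝ} (hf : IsTestFun f) : 𝓢(R3, ℂ) :=
  hf.hasCompactSupport_ofReal.toSchwartzMap hf.contDiff_ofReal

@[simp]
lemma IsTestFun.toSchwartz_apply {f : R3 → ℝ} (hf : IsTestFun f) (x : R3) :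
    hf.toSchwartz x = f x := rfl

lemma IsTestFun.partialD {f : R3 → ℝ} (hf : IsTestFun f) (i : Fin 3) :
    IsTestFun (partialD i f) :=
  ⟨(hf.1.fderiv_right (m := ∞) (by simp)).clm_apply contDiff_const, hf.2.fderiv_apply ℝ _⟩

lemma IsTestFun.toSchwartz_partialD {f : R3 → ℝ} (hf : IsTestFun f) (i : Fin 3) :
    (hf.partialD i).toSchwartz = ∂_{stdVec i} hf.toSchwartz := by
  ext x
  rw [lineDerivOp_apply_eq_fderiv]
  have h : HasFDerivAt f (fderiv ℝ f x) x :=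
    (hf.1.differentiable (by simp) x).hasFDerivAt
  have h2 : HasFDerivAt (fun y => (f y : ℂ)) (Complex.ofRealCLM.comp (fderiv ℝ f x)) x :=
    Complex.ofRealCLM.hasFDerivAt.comp x h
  have h3 : fderiv ℝ (hf.toSchwartz : R3 → ℂ) x = Complex.ofRealCLM.comp (fderiv ℝ f x) :=
    h2.fderiv
  rw [h3]
  rfl

/-- On the Fourier side both derivatives are multiplications by functions, which commute. -/
lemma lineDerivOp_comm (a b : R3) (φ : 𝓢(R3, ℂ)) : ∂_{a} (∂_{b} φ) = ∂_{b} (∂_{a} φ) := by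
  have ha : (inner ℝ · a : R3 → ℝ).HasTemperateGrowth := by fun_prop
  have hb : (inner ℝ · b : R3 → ℝ).HasTemperateGrowth := by fun_prop
  obtain ⟨ψ, rfl⟩ : ∃ ψ : 𝓢(R3, ℂ), 𝓕 ψ = φ := ⟨𝓕⁻ φ, fourier_fourierInv_eq φ⟩
  simp only [lineDerivOp_fourier_eq]
  congr 1
  ext x
  simp [smulLeftCLM_apply_apply ha, smulLeftCLM_apply_apply hb]
  ring

/-! ### Real square integrable functions as tempered distributions -/

lemma coeFn_toComplex (f : L2) : (f.toComplex : R3 → ℂ) =ᵐ[volume] fun x => (f x : ℂ) :=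
  Complex.ofRealCLM.coeFn_compLp f

/-- The tempered distribution given by a real square integrable function. -/
def L2.toDistribution (f : L2) : 𝓢'(R3, ℂ) := Lp.toTemperedDistribution f.toComplex

lemma L2.toDistribution_apply (f : L2) (φ : 𝓢(R3, ℂ)) :
    f.toDistribution φ = ∫ x, φ x * f x := by
  rw [L2.toDistribution, Lp.toTemperedDistribution_apply]
  refine integral_congr_ae ?_
  filter_upwards [coeFn_toComplex f] with x hx
  rw [hx, smul_eq_mul]

lemma integrable_schwartz_mul (f : L2) (φ : 𝓢(R3, ℂ)) :
    Integrable (fun x => φ x * (f x : ℂ)) :=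
  MemLp.integrable_mul (p := 2) (q := 2) (φ.memLp 2) (Lp.memLp f).ofReal

lemma integrable_mul_testFun (f : L2) {g : R3 → ℝ} (hg : IsTestFun g) :
    Integrable (fun x => f x * g x) :=
  MemLp.integrable_mul (p := 2) (q := 2) (Lp.memLp f)
    (hg.1.continuous.memLp_of_hasCompactSupport hg.2)

/-- The pairing of a matrix of square integrable functions with a test field in terms of the
associated distributions. -/
lemma ofReal_l2Pairing (S : Matrix (Fin 3) (Fin 3) L2) {M : R3 → Matrix (Fin 3) (Fin 3) ℝ}
    (hM : ∀ i j, IsTestFun (fun x => M x i j)) :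
    (l2Pairing S M : ℂ) = ∑ i, ∑ j, (S i j).toDistribution (hM i j).toSchwartz := by
  have h : l2Pairing S M = ∑ i, ∑ j, ∫ x, S i j x * M x i j := by
    rw [l2Pairing, integral_finsetSum]
    · refine Finset.sum_congr rfl fun i _ => integral_finsetSum _ fun j _ => ?_
      exact integrable_mul_testFun (S i j) (hM i j)
    · exact fun i _ => integrable_finsetSum _ fun j _ => integrable_mul_testFun (S i j) (hM i j)
  rw [h]
  push_cast
  refine Finset.sum_congr rfl fun i _ => Finset.sum_congr rfl fun j _ => ?_
  rw [L2.toDistribution_apply, ← integral_complex_ofReal]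
  refine integral_congr_ae (Filter.Eventually.of_forall fun x => ?_)
  simp [mul_comm]

/-! ### Strain matrices satisfy the orthogonality conditions -/

section Orthogonality

variable {v : Fin 3 → 𝓢'(R3, ℂ)}

lemma symGrad_apply (v : Fin 3 → 𝓢'(R3, ℂ)) (i j : Fin 3) (φ : 𝓢(R3, ℂ)) :
    symGrad v i j φ = -(1 / 2 : ℂ) * (v j (∂_{stdVec i} φ) + v i (∂_{stdVec j} φ)) := by
  have h : symGrad v i j φ =
      (1 / 2 : ℂ) * ((∂_{stdVec i} (v j)) φ + (∂_{stdVec j} (v i)) φ) := rfl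
  rw [h]
  simp only [TemperedDistribution.lineDerivOp_apply_apply, map_neg]
  ring

lemma sum_apply_lineDerivOp_eq_zero (hv : ∑ i, ∂_{stdVec i} (v i) = 0) (φ : 𝓢(R3, ℂ)) :
    ∑ i, v i (∂_{stdVec i} φ) = 0 := by
  have h := congrArg (fun T : 𝓢'(R3, ℂ) => T φ) hv
  have h2 : (∑ i, ∂_{stdVec i} (v i)) φ = ∑ i, (∂_{stdVec i} (v i)) φ := by
    simp [Fin.sum_univ_three]
    ring
  simp only [h2, TemperedDistribution.lineDerivOp_apply_apply, map_neg,
    Finset.sum_neg_distrib] at h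
  simpa using h

/-- A symmetric gradient annihilates divergence free symmetric fields. -/
lemma sum_symGrad_apply_eq_zero {Φ : Fin 3 → Fin 3 → 𝓢(R3, ℂ)} (hsymm : ∀ i j, Φ i j = Φ j i)
    (hdiv : ∀ j, ∑ i, ∂_{stdVec i} (Φ i j) = 0) :
    ∑ i, ∑ j, symGrad v i j (Φ i j) = 0 := by
  have h1 : ∑ i, ∑ j, v j (∂_{stdVec i} (Φ i j)) = 0 := by
    rw [Finset.sum_comm]
    refine Finset.sum_eq_zero fun j _ => ?_
    rw [← map_sum, hdiv, map_zero]
  have h2 : ∑ i, ∑ j, v i (∂_{stdVec j} (Φ i j)) = 0 := by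
    refine Finset.sum_eq_zero fun i _ => ?_
    simp_rw [hsymm i]
    rw [← map_sum, hdiv, map_zero]
  simp only [symGrad_apply, ← Finset.mul_sum, Finset.sum_add_distrib, h1, h2]
  simp

/-- The symmetric gradient of a divergence free field is trace free. -/
lemma sum_symGrad_diag_eq_zero (hv : ∑ i, ∂_{stdVec i} (v i) = 0) (φ : 𝓢(R3, ℂ)) :
    ∑ i, symGrad v i i φ = 0 := by
  simp only [symGrad_apply, ← Finset.mul_sum, Finset.sum_add_distrib,
    sum_apply_lineDerivOp_eq_zero hv]
  simp

/-- The symmetric gradient of a divergence free field annihilates Hessians. -/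
lemma sum_symGrad_hess_eq_zero (hv : ∑ i, ∂_{stdVec i} (v i) = 0) (φ : 𝓢(R3, ℂ)) :
    ∑ i, ∑ j, symGrad v i j (∂_{stdVec i} (∂_{stdVec j} φ)) = 0 := by
  -- With ∂ⱼ moved outermost, each inner sum is, up to sign, div v tested against ∂ᵢ∂ᵢφ.
  have h1 : ∑ i, ∑ j, v j (∂_{stdVec i} (∂_{stdVec i} (∂_{stdVec j} φ))) = 0 := by
    refine Finset.sum_eq_zero fun i _ => ?_
    simp_rw [lineDerivOp_comm (stdVec i) (stdVec _)]
    exact sum_apply_lineDerivOp_eq_zero hv _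
  have h2 : ∑ i, ∑ j, v i (∂_{stdVec j} (∂_{stdVec i} (∂_{stdVec j} φ))) = 0 := by
    rw [Finset.sum_comm]
    refine Finset.sum_eq_zero fun j _ => ?_
    simp_rw [lineDerivOp_comm (stdVec j) (stdVec _)]
    exact sum_apply_lineDerivOp_eq_zero hv _
  simp only [symGrad_apply, ← Finset.mul_sum, Finset.sum_add_distrib, h1, h2]
  simp

end Orthogonality

lemma l2Pairing_eq_zero_of_mem_L2st {S : Matrix (Fin 3) (Fin 3) L2} (hS : S ∈ L2st) :
    (∀ f : R3 → ℝ, IsTestFun f → l2Pairing S (hess f) = 0) ∧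
    (∀ g : R3 → ℝ, IsTestFun g →
      l2Pairing S (fun x => g x • (1 : Matrix (Fin 3) (Fin 3) ℝ)) = 0) ∧
    (∀ M : R3 → Matrix (Fin 3) (Fin 3) ℝ, IsSymTestField M →
      (∀ x j, matDiv M x j = 0) → l2Pairing S M = 0) := by
  obtain ⟨-, u, hu, hSu⟩ := hS
  set v := fun k => invSqrtLaplacian (u k) with hv
  replace hu : ∑ i, ∂_{stdVec i} (v i) = 0 := hu
  replace hSu : ∀ i j, (S i j).toDistribution = symGrad v i j := hSu
  refine ⟨fun f hf => ?_, fun g hg => ?_, fun M hM hdiv => ?_⟩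
  · have hM : ∀ i j, IsTestFun (fun x => hess f x i j) := fun i j => (hf.partialD j).partialD i
    rw [← Complex.ofReal_eq_zero, ofReal_l2Pairing S hM]
    have : ∀ i j, (hM i j).toSchwartz = ∂_{stdVec i} (∂_{stdVec j} hf.toSchwartz) :=
      fun i j => by
        rw [← hf.toSchwartz_partialD, ← (hf.partialD j).toSchwartz_partialD]
        rfl
    simp only [this, hSu]
    exact sum_symGrad_hess_eq_zero hu _
  · have hM : ∀ i j, IsTestFun (fun x => (g x • (1 : Matrix (Fin 3) (Fin 3) ℝ)) i j) :=
      fun i j => ⟨hg.1.mul contDiff_const, hg.2.mul_right⟩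
    rw [← Complex.ofReal_eq_zero, ofReal_l2Pairing S hM]
    have h1 : ∀ i, (hM i i).toSchwartz = hg.toSchwartz := fun i => by ext x; simp
    have h0 : ∀ i j, i ≠ j → (hM i j).toSchwartz = 0 := fun i j hij => by
      ext x
      simp [Matrix.one_apply_ne hij]
    rw [← sum_symGrad_diag_eq_zero hu hg.toSchwartz]
    refine Finset.sum_congr rfl fun i _ => ?_
    rw [Finset.sum_eq_single i, h1, hSu]
    · intro j _ hj
      rw [h0 i j hj.symm, map_zero]
    · simp
  · rw [← Complex.ofReal_eq_zero, ofReal_l2Pairing S hM.2]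
    simp only [hSu]
    refine sum_symGrad_apply_eq_zero (fun i j => ?_) fun j => ?_
    · ext x
      simp [(hM.1 x).apply i j]
    · ext x
      have := hdiv x j
      simp only [← (hM.2 _ j).toSchwartz_partialD, sum_apply, IsTestFun.toSchwartz_apply]
      rw [← Complex.ofReal_sum]
      exact congrArg _ this

/-! ### Constant coefficient differential operators -/

/-- The operator on Schwartz functions which multiplies the inverse Fourier transform by `g`. -/
def symbolOp (g : R3 → ℂ) : 𝓢(R3, ℂ) →L[ℂ] 𝓢(R3, ℂ) :=
  fourierCLM ℂ 𝓢(R3, ℂ) ∘L smulLeftCLM ℂ g ∘L fourierInvCLM ℂ 𝓢(R3, ℂ)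

lemma symbolOp_apply (g : R3 → ℂ) (φ : 𝓢(R3, ℂ)) :
    symbolOp g φ = 𝓕 (smulLeftCLM ℂ g (𝓕⁻ φ)) := rfl

/-- Symbols of temperate growth whose operators preserve compact supports. -/
structure IsLocalSymbol (g : R3 → ℂ) : Prop where
  temperate : g.HasTemperateGrowth
  hasCompactSupport : ∀ φ : 𝓢(R3, ℂ), HasCompactSupport φ → HasCompactSupport (symbolOp g φ)

lemma symbolOp_const (c : ℂ) (φ : 𝓢(R3, ℂ)) : symbolOp (fun _ => c) φ = c • φ := by
  rw [symbolOp_apply, smulLeftCLM_const]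
  simp [FourierTransform.fourier_smul]

lemma symbolOp_add {g h : R3 → ℂ} (hg : g.HasTemperateGrowth) (hh : h.HasTemperateGrowth)
    (φ : 𝓢(R3, ℂ)) : symbolOp (g + h) φ = symbolOp g φ + symbolOp h φ := by
  simp [symbolOp_apply, smulLeftCLM_add hg hh, FourierTransform.fourier_add]

lemma symbolOp_mul {g h : R3 → ℂ} (hg : g.HasTemperateGrowth) (hh : h.HasTemperateGrowth)
    (φ : 𝓢(R3, ℂ)) : symbolOp (g * h) φ = symbolOp g (symbolOp h φ) := by
  simp [symbolOp_apply, smulLeftCLM_smulLeftCLM_apply hg hh]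

/-- The symbol of the partial derivative `∂ᵢ`. -/
def derivSymbol (i : Fin 3) (ξ : R3) : ℂ := -(2 * Real.pi * Complex.I) * (ξ i : ℂ)

lemma inner_stdVec (i : Fin 3) (ξ : R3) : inner ℝ ξ (stdVec i) = ξ i := by
  simp [stdVec, EuclideanSpace.inner_single_right]

lemma hasTemperateGrowth_derivSymbol (i : Fin 3) : (derivSymbol i).HasTemperateGrowth := by
  have : derivSymbol i = fun ξ => -(2 * Real.pi * Complex.I) *
      ((inner ℝ ξ (stdVec i) : ℝ) : ℂ) := by
    ext ξ
    rw [derivSymbol, inner_stdVec]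
  rw [this]
  fun_prop

/-- The minus sign in `derivSymbol` arises because `symbolOp` multiplies the inverse Fourier
transform, not the direct one. -/
lemma symbolOp_derivSymbol (i : Fin 3) (φ : 𝓢(R3, ℂ)) :
    symbolOp (derivSymbol i) φ = ∂_{stdVec i} φ := by
  have ht : (inner ℝ · (stdVec i) : R3 → ℝ).HasTemperateGrowth := by fun_prop
  obtain ⟨ψ, rfl⟩ : ∃ ψ : 𝓢(R3, ℂ), 𝓕 ψ = φ := ⟨𝓕⁻ φ, fourier_fourierInv_eq φ⟩
  rw [symbolOp_apply, fourierInv_fourier_eq, lineDerivOp_fourier_eq]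
  congr 1
  ext ξ
  rw [smulLeftCLM_apply_apply (hasTemperateGrowth_derivSymbol i), smul_apply,
    smulLeftCLM_apply_apply ht, inner_stdVec, derivSymbol, Complex.real_smul, smul_eq_mul,
    smul_eq_mul, mul_assoc]

namespace IsLocalSymbol

variable {g h : R3 → ℂ}

lemma const (c : ℂ) : IsLocalSymbol (fun _ => c) where
  temperate := .const c
  hasCompactSupport φ hφ := by
    rw [symbolOp_const]
    exact hφ.smul_left (f := fun _ => c)

lemma add (hg : IsLocalSymbol g) (hh : IsLocalSymbol h) : IsLocalSymbol (g + h) where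
  temperate := hg.temperate.add hh.temperate
  hasCompactSupport φ hφ := by
    rw [symbolOp_add hg.temperate hh.temperate]
    exact (hg.hasCompactSupport φ hφ).add (hh.hasCompactSupport φ hφ)

lemma mul (hg : IsLocalSymbol g) (hh : IsLocalSymbol h) : IsLocalSymbol (g * h) where
  temperate := hg.temperate.mul hh.temperate
  hasCompactSupport φ hφ := by
    rw [symbolOp_mul hg.temperate hh.temperate]
    exact hg.hasCompactSupport _ (hh.hasCompactSupport φ hφ)

lemma derivSymbol (i : Fin 3) : IsLocalSymbol (derivSymbol i) where
  temperate := hasTemperateGrowth_derivSymbol i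
  hasCompactSupport φ hφ := by
    rw [symbolOp_derivSymbol]
    exact hφ.of_isClosed_subset (isClosed_tsupport _) (tsupport_lineDerivOp_subset _ φ)

lemma neg (hg : IsLocalSymbol g) : IsLocalSymbol (-g) := by
  have : -g = (fun _ => (-1 : ℂ)) * g := by ext; simp
  rw [this]
  exact (const _).mul hg

lemma sub (hg : IsLocalSymbol g) (hh : IsLocalSymbol h) : IsLocalSymbol (g - h) := by
  rw [sub_eq_add_neg]
  exact hg.add hh.neg

end IsLocalSymbol

/-! ### The Fourier side of an orthogonality relation -/

/-- Duality involves neither conjugation nor reflection, so a symbol applied to ψ passes unchanged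
to the transform of f. -/
lemma L2.toDistribution_fourier_apply (f : L2) (ψ : 𝓢(R3, ℂ)) :
    f.toDistribution (𝓕 ψ) = ∫ ξ, ψ ξ * (𝓕 f.toComplex : L2C) ξ := by
  have := congrArg (fun T : 𝓢'(R3, ℂ) => T ψ) (Lp.fourier_toTemperedDistribution_eq f.toComplex)
  simp only [TemperedDistribution.fourier_apply] at this
  rw [L2.toDistribution, this, Lp.toTemperedDistribution_apply]
  rfl

/-- Locally integrable functions with the same integrals against all Schwartz functions are equal
almost everywhere. -/
lemma ae_eq_of_integral_schwartz_mul_eq {f g : R3 → ℂ} (hf : LocallyIntegrable f)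
    (hg : LocallyIntegrable g) (h : ∀ φ : 𝓢(R3, ℂ), ∫ x, φ x * f x = ∫ x, φ x * g x) :
    ∀ᵐ x, f x = g x := by
  refine ae_eq_of_integral_contDiff_smul_eq hf hg fun k hk hkc => ?_
  exact h (IsTestFun.toSchwartz ⟨hk, hkc⟩)

lemma integrable_schwartz_mul_symbol_mul {m : R3 → ℂ} (hm : m.HasTemperateGrowth) (f : L2C)
    (ψ : 𝓢(R3, ℂ)) : Integrable (fun ξ => ψ ξ * (m ξ * f ξ)) := by
  have : (fun ξ => ψ ξ * (m ξ * f ξ)) = fun ξ => smulLeftCLM ℂ m ψ ξ * f ξ := by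
    ext ξ
    rw [smulLeftCLM_apply_apply hm, smul_eq_mul]
    ring
  rw [this]
  exact MemLp.integrable_mul (p := 2) (q := 2) ((smulLeftCLM ℂ m ψ).memLp 2) (Lp.memLp f)

lemma locallyIntegrable_symbol_mul {m : R3 → ℂ} (hm : m.HasTemperateGrowth) (f : L2C) :
    LocallyIntegrable (fun ξ => m ξ * f ξ) := by
  have h := (Lp.memLp f).locallyIntegrable (by norm_num)
  rw [← locallyIntegrableOn_univ] at h ⊢
  exact h.continuousOn_mul hm.1.continuous.continuousOn isClosed_univ.isLocallyClosed

/-- If `S` is orthogonal to the real parts of all fields `(m i j (D) φ)`, where `φ` is smooth and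
compactly supported, then `∑ᵢⱼ mᵢⱼ(ξ) 𝓕 Sᵢⱼ(ξ) = 0` for almost every `ξ`. -/
lemma ae_sum_symbol_mul_fourier_eq_zero (S : Matrix (Fin 3) (Fin 3) L2)
    {m : Fin 3 → Fin 3 → R3 → ℂ} (hm : ∀ i j, IsLocalSymbol (m i j))
    (h : ∀ φ : 𝓢(R3, ℂ), HasCompactSupport φ →
      l2Pairing S (fun x => Matrix.of fun i j => (symbolOp (m i j) φ x).re) = 0) :
    ∀ᵐ ξ, ∑ i, ∑ j, m i j ξ * (𝓕 (S i j).toComplex : L2C) ξ = 0 := by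
  -- As S is real, pairing it with the real part of a field gives the real part of the complex
  -- pairing.
  have hre : ∀ φ : 𝓢(R3, ℂ), HasCompactSupport φ →
      (∑ i, ∑ j, (S i j).toDistribution (symbolOp (m i j) φ)).re = 0 := by
    intro φ hφ
    have hM : ∀ i j, IsTestFun (fun x => (symbolOp (m i j) φ x).re) := fun i j =>
      ⟨Complex.reCLM.contDiff.comp ((symbolOp (m i j) φ).smooth ⊤),
        ((hm i j).hasCompactSupport φ hφ).comp_left (g := Complex.re) Complex.zero_re⟩
    have h1 := h φ hφ
    rw [← Complex.ofReal_eq_zero, ofReal_l2Pairing S (M := fun x =>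
      Matrix.of fun i j => (symbolOp (m i j) φ x).re) hM] at h1
    rw [← Complex.zero_re, ← h1]
    simp only [Complex.re_sum]
    refine Finset.sum_congr rfl fun i _ => Finset.sum_congr rfl fun j _ => ?_
    rw [L2.toDistribution_apply, L2.toDistribution_apply, ← Complex.reCLM_apply,
      ← Complex.reCLM_apply, ← Complex.reCLM.integral_comp_comm (integrable_schwartz_mul _ _),
      ← Complex.reCLM.integral_comp_comm (integrable_schwartz_mul _ _)]
    simp
  let W : 𝓢(R3, ℂ) → ℂ := fun φ => ∑ i, ∑ j, (S i j).toDistribution (symbolOp (m i j) φ)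
  have hWc : Continuous W := continuous_finsetSum _ fun i _ => continuous_finsetSum _ fun j _ =>
    (map_continuous (S i j).toDistribution).comp (symbolOp (m i j)).continuous
  have hzero : ∀ φ : 𝓢(R3, ℂ), HasCompactSupport φ → W φ = 0 := by
    intro φ hφ
    refine Complex.ext ?_ ?_
    · exact hre φ hφ
    -- Re(-i W) = Im W, so the real statement for -iφ controls the imaginary part for φ.
    · have h2 : (W ((-Complex.I) • φ)).re = 0 :=
        hre _ (hφ.smul_left (f := fun _ => -Complex.I))
      have h3 : W ((-Complex.I) • φ) = -Complex.I * W φ := by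
        simp only [W, map_smul, smul_eq_mul, Finset.mul_sum]
      rw [h3] at h2
      simpa using h2
  have hW0 : ∀ φ, W φ = 0 := by
    have := Continuous.ext_on dense_hasCompactSupport hWc
      (continuous_const (y := (0 : ℂ))) fun φ hφ => hzero φ hφ
    exact congrFun this
  have hloc : LocallyIntegrable
      (fun ξ => ∑ i, ∑ j, m i j ξ * (𝓕 (S i j).toComplex : L2C) ξ) := by
    refine locallyIntegrable_finsetSum _ fun i _ => locallyIntegrable_finsetSum _ fun j _ => ?_
    exact locallyIntegrable_symbol_mul (hm i j).temperate _
  refine ae_eq_of_integral_schwartz_mul_eq hloc (g := fun _ => 0) locallyIntegrable_zero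
    fun ψ => ?_
  have h3 := hW0 (𝓕 ψ)
  simp only [mul_zero, integral_zero]
  rw [← h3]
  simp only [W]
  simp only [Finset.mul_sum]
  have hint := fun i j => integrable_schwartz_mul_symbol_mul (hm i j).temperate
    (𝓕 (S i j).toComplex : L2C) ψ
  rw [integral_finsetSum _ fun i _ => integrable_finsetSum _ fun j _ => hint i j]
  refine Finset.sum_congr rfl fun i _ => ?_
  rw [integral_finsetSum _ fun j _ => hint i j]
  refine Finset.sum_congr rfl fun j _ => ?_
  rw [symbolOp_apply, fourierInv_fourier_eq, L2.toDistribution_fourier_apply]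
  refine integral_congr_ae (Filter.Eventually.of_forall fun ξ => ?_)
  simp only [smulLeftCLM_apply_apply (hm i j).temperate, smul_eq_mul]
  ring

/-! ### Real functions and Hermitian symmetry of the Fourier transform -/

section Hermitian

open ComplexConjugate

/-- The Schwartz function `ξ ↦ conj (ψ (-ξ))`. -/
def conjReflect (ψ : 𝓢(R3, ℂ)) : 𝓢(R3, ℂ) :=
  (compCLMOfContinuousLinearEquiv ℝ (ContinuousLinearEquiv.neg ℝ) ψ).postcompCLM
    (Complex.conjCLE : ℂ →L[ℝ] ℂ)

lemma conjReflect_apply (ψ : 𝓢(R3, ℂ)) (ξ : R3) : conjReflect ψ ξ = conj (ψ (-ξ)) := by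
  simp [conjReflect]

lemma fourier_conjReflect_apply (ψ : 𝓢(R3, ℂ)) (x : R3) :
    𝓕 (conjReflect ψ) x = conj (𝓕 ψ x) := by
  simp only [fourier_coe, Real.fourier_eq]
  rw [← integral_conj, ← integral_neg_eq_self]
  refine integral_congr_ae (Filter.Eventually.of_forall fun ξ => ?_)
  simp [conjReflect_apply, Circle.smul_def, Real.fourierChar_apply, ← Complex.exp_conj, map_ofNat]

lemma integral_schwartz_mul_fourier (g : L2C) (ψ : 𝓢(R3, ℂ)) :
    ∫ ξ, ψ ξ * (𝓕 g : L2C) ξ = ∫ x, 𝓕 ψ x * g x := by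
  have := congrArg (fun T : 𝓢'(R3, ℂ) => T ψ) (Lp.fourier_toTemperedDistribution_eq g)
  simp only [TemperedDistribution.fourier_apply, Lp.toTemperedDistribution_apply] at this
  exact this.symm

/-- Weak form of the rule that conjugating g conjugates and reflects its Fourier transform; the rule
is moved onto the Schwartz function by `conjReflect`. -/
lemma integral_fourier_mul_conj (g : L2C) (ψ : 𝓢(R3, ℂ)) :
    ∫ x, 𝓕 ψ x * conj (g x) = ∫ ξ, ψ ξ * conj ((𝓕 g : L2C) (-ξ)) := by
  have h := congrArg conj (integral_schwartz_mul_fourier g (conjReflect ψ))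
  rw [← integral_conj, ← integral_conj] at h
  simp only [map_mul, conjReflect_apply, fourier_conjReflect_apply, Complex.conj_conj] at h
  rw [← h, ← integral_neg_eq_self]
  simp

lemma locallyIntegrable_conj (g : L2C) : LocallyIntegrable (fun x => conj (g x)) :=
  MemLp.locallyIntegrable (p := 2) (Lp.memLp g).star (by norm_num)

lemma locallyIntegrable_conj_neg (g : L2C) : LocallyIntegrable (fun x => conj (g (-x))) :=
  MemLp.locallyIntegrable (p := 2)
    ((Lp.memLp g).comp_measurePreserving (Measure.measurePreserving_neg volume)).star
    (by norm_num)

/-- A square integrable function is real valued if and only if its Fourier transform is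
Hermitian. -/
lemma ae_conj_eq_self_iff (g : L2C) :
    (∀ᵐ x, conj (g x) = g x) ↔ ∀ᵐ ξ, conj ((𝓕 g : L2C) (-ξ)) = (𝓕 g : L2C) ξ := by
  have hloc : ∀ f : L2C, LocallyIntegrable f := fun f =>
    (Lp.memLp f).locallyIntegrable (by norm_num)
  constructor
  · intro h
    refine ae_eq_of_integral_schwartz_mul_eq (locallyIntegrable_conj_neg _) (hloc _) fun ψ => ?_
    rw [← integral_fourier_mul_conj, integral_schwartz_mul_fourier]
    refine integral_congr_ae ?_
    filter_upwards [h] with x hx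
    rw [hx]
  · intro h
    refine ae_eq_of_integral_schwartz_mul_eq (locallyIntegrable_conj _) (hloc _) fun φ => ?_
    obtain ⟨ψ, rfl⟩ : ∃ ψ : 𝓢(R3, ℂ), 𝓕 ψ = φ := ⟨𝓕⁻ φ, fourier_fourierInv_eq φ⟩
    rw [integral_fourier_mul_conj, ← integral_schwartz_mul_fourier]
    refine integral_congr_ae ?_
    filter_upwards [h] with x hx
    rw [hx]

lemma ae_conj_fourier_toComplex (f : L2) :
    ∀ᵐ ξ, conj ((𝓕 f.toComplex : L2C) (-ξ)) = (𝓕 f.toComplex : L2C) ξ := by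
  refine (ae_conj_eq_self_iff _).1 ?_
  filter_upwards [coeFn_toComplex f] with x hx
  rw [hx, Complex.conj_ofReal]

/-- A square integrable Hermitian function is the Fourier transform of a real function. -/
lemma exists_fourier_toComplex_eq (w : L2C) (hw : ∀ᵐ ξ, conj (w (-ξ)) = w ξ) :
    ∃ u : L2, 𝓕 u.toComplex = w := by
  have hg := (ae_conj_eq_self_iff (𝓕⁻ w)).2 (by rwa [fourier_fourierInv_eq])
  refine ⟨Complex.reCLM.compLp (𝓕⁻ w : L2C), ?_⟩
  suffices h : L2.toComplex (Complex.reCLM.compLp (𝓕⁻ w : L2C)) = 𝓕⁻ w by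
    rw [h, fourier_fourierInv_eq]
  refine Lp.ext ?_
  filter_upwards [coeFn_toComplex (Complex.reCLM.compLp (𝓕⁻ w : L2C)),
    Complex.reCLM.coeFn_compLp (𝓕⁻ w : L2C), hg] with x h1 h2 h3
  rw [h1, h2, Complex.reCLM_apply, Complex.conj_eq_iff_re.1 h3]

end Hermitian

/-! ### Trace free symmetric matrices transverse to a vector -/

section Transverse

variable {R : Type*} [CommRing R]

/-- The matrix `|d|² I - d ⊗ d`. -/
def transverseMat (d : Fin 3 → R) (i j : Fin 3) : R :=
  (if i = j then ∑ k, d k * d k else 0) - d i * d j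

/-- The trace free symmetric matrix `P Q P - ½ tr(P Q) P`, where `P` is `|d|² I - d ⊗ d` and
`Q = e_a ⊗ e_b + e_b ⊗ e_a`. -/
def transverseTraceFree (d : Fin 3 → R) (a b i j : Fin 3) : R :=
  transverseMat d i a * transverseMat d b j + transverseMat d i b * transverseMat d a j -
    transverseMat d a b * transverseMat d i j

lemma transverseMat_comm (d : Fin 3 → R) (i j : Fin 3) :
    transverseMat d i j = transverseMat d j i := by
  rw [transverseMat, transverseMat, mul_comm]
  rcases eq_or_ne i j with rfl | h
  · rfl
  · rw [if_neg h, if_neg h.symm]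

lemma sum_mul_transverseMat (d : Fin 3 → R) (j : Fin 3) :
    ∑ i, d i * transverseMat d i j = 0 := by
  fin_cases j <;> simp [transverseMat, Fin.sum_univ_three] <;> ring

lemma sum_transverseMat_mul (d : Fin 3 → R) (a b : Fin 3) :
    ∑ i, transverseMat d i a * transverseMat d b i = (∑ k, d k * d k) * transverseMat d a b := by
  fin_cases a <;> fin_cases b <;> simp [transverseMat, Fin.sum_univ_three] <;> ring

lemma transverseTraceFree_comm (d : Fin 3 → R) (a b i j : Fin 3) :
    transverseTraceFree d a b i j = transverseTraceFree d a b j i := by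
  rw [transverseTraceFree, transverseTraceFree, transverseMat_comm d j i,
    transverseMat_comm d j a, transverseMat_comm d j b, transverseMat_comm d b i,
    transverseMat_comm d a i]
  ring

lemma sum_mul_transverseTraceFree (d : Fin 3 → R) (a b j : Fin 3) :
    ∑ i, d i * transverseTraceFree d a b i j = 0 := by
  have h : ∀ i, d i * transverseTraceFree d a b i j =
      (d i * transverseMat d i a) * transverseMat d b j +
      (d i * transverseMat d i b) * transverseMat d a j -
      (d i * transverseMat d i j) * transverseMat d a b := fun i => by
    rw [transverseTraceFree]
    ring
  simp only [h, Finset.sum_sub_distrib, Finset.sum_add_distrib, ← Finset.sum_mul,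
    sum_mul_transverseMat]
  simp

/-- With P the transverse matrix, P² = |d|² P gives the first two terms trace 2|d|² P_ab. The last
term cancels this because tr P = 2|d|², the 2 being the dimension of the space transverse to d. -/
lemma sum_transverseTraceFree_diag (d : Fin 3 → R) (a b : Fin 3) :
    ∑ i, transverseTraceFree d a b i i = 0 := by
  have htr : ∑ i, transverseMat d i i = 2 * ∑ k, d k * d k := by
    simp [transverseMat, Fin.sum_univ_three]
    ring
  simp only [transverseTraceFree, Finset.sum_sub_distrib, Finset.sum_add_distrib,
    ← Finset.mul_sum, sum_transverseMat_mul, htr, transverseMat_comm d b a]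
  ring

/-- A symmetric matrix annihilated by `d ⊗ d`, the identity, and the trace free symmetric matrices
transverse to `d`, is of the form `d ⊗ q + q ⊗ d` up to the factor `|d|²`. -/
lemma sum_mul_self_mul_eq_of_orthogonal [IsDomain R] [CharZero R] {d : Fin 3 → R} {H : Fin 3 → Fin 3 → R}
    (hd : ∑ k, d k * d k ≠ 0) (hH : ∀ i j, H i j = H j i)
    (h1 : ∑ i, ∑ j, d i * d j * H i j = 0) (h2 : ∑ i, H i i = 0)
    (h3 : ∀ a b, ∑ i, ∑ j, transverseTraceFree d a b i j * H i j = 0) (a b : Fin 3) :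
    (∑ k, d k * d k) * H a b = d a * ∑ k, d k * H k b + d b * ∑ k, d k * H k a := by
  have key : (2 * ∑ k, d k * d k) * ((∑ k, d k * d k) * H a b -
      (d a * ∑ k, d k * H k b + d b * ∑ k, d k * H k a)) = 0 := by
    have e3 := h3 a b
    -- The sum against `transverseTraceFree` is 2(PHP)_ab - P_ab tr(PH), with tr(PH) = |d|² tr H -
    -- d·Hd. Expanding PHP = |d|⁴H - |d|²(d ⊗ Hd + Hd ⊗ d) + (d·Hd) d ⊗ d gives the identity.
    have hex : (2 * ∑ k, d k * d k) * ((∑ k, d k * d k) * H a b -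
        (d a * ∑ k, d k * H k b + d b * ∑ k, d k * H k a)) =
        ∑ i, ∑ j, transverseTraceFree d a b i j * H i j +
        transverseMat d a b * ((∑ k, d k * d k) * ∑ i, H i i - ∑ i, ∑ j, d i * d j * H i j) -
        2 * d a * d b * ∑ i, ∑ j, d i * d j * H i j := by
      clear h1 h2 h3 e3 hd
      have h10 := hH 1 0
      have h20 := hH 2 0
      have h21 := hH 2 1
      fin_cases a <;> fin_cases b <;>
        simp [transverseTraceFree, transverseMat, Fin.sum_univ_three, h10, h20, h21] <;> ring
    rw [hex, e3, h1, h2]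
    ring
  exact sub_eq_zero.1 ((mul_eq_zero.1 key).resolve_left (mul_ne_zero two_ne_zero hd))

end Transverse

lemma IsLocalSymbol.transverseMat (i j : Fin 3) :
    IsLocalSymbol (_root_.transverseMat _root_.derivSymbol i j) := by
  refine IsLocalSymbol.sub ?_ ((IsLocalSymbol.derivSymbol i).mul (.derivSymbol j))
  split_ifs
  · rw [Fin.sum_univ_three]
    exact (((IsLocalSymbol.derivSymbol 0).mul (.derivSymbol 0)).add
      ((IsLocalSymbol.derivSymbol 1).mul (.derivSymbol 1))).add
      ((IsLocalSymbol.derivSymbol 2).mul (.derivSymbol 2))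
  · exact .const 0

lemma IsLocalSymbol.transverseTraceFree (a b i j : Fin 3) :
    IsLocalSymbol (_root_.transverseTraceFree _root_.derivSymbol a b i j) :=
  (((transverseMat i a).mul (transverseMat b j)).add
    ((transverseMat i b).mul (transverseMat a j))).sub ((transverseMat a b).mul (transverseMat i j))

/-- Links the two rings in which the transverse algebra is used: functions of ξ, to build the test
fields, and ℂ at a fixed ξ, to solve for the matrix. -/
lemma transverseTraceFree_derivSymbol_apply (a b i j : Fin 3) (ξ : R3) :
    transverseTraceFree derivSymbol a b i j ξ =
      transverseTraceFree (fun k => derivSymbol k ξ) a b i j := by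
  have h : ∀ i j, transverseMat derivSymbol i j ξ =
      transverseMat (fun k => derivSymbol k ξ) i j := fun i j => by
    unfold transverseMat
    split_ifs <;> simp
  simp [transverseTraceFree, h]

/-! ### The orthogonality conditions on the Fourier side -/

section FourierConditions

variable {S : Matrix (Fin 3) (Fin 3) L2}

lemma isTestFun_re {φ : 𝓢(R3, ℂ)} (hφ : HasCompactSupport φ) : IsTestFun (fun x => (φ x).re) :=
  ⟨Complex.reCLM.contDiff.comp (φ.smooth ⊤), hφ.comp_left (g := Complex.re) Complex.zero_re⟩

lemma partialD_re (i : Fin 3) (φ : 𝓢(R3, ℂ)) :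
    partialD i (fun x => (φ x).re) = fun x => (∂_{stdVec i} φ x).re := by
  ext x
  have h : HasFDerivAt (fun y => (φ y).re) (Complex.reCLM.comp (fderiv ℝ φ x)) x :=
    Complex.reCLM.hasFDerivAt.comp x (φ.hasFDerivAt x)
  rw [partialD, h.fderiv, lineDerivOp_apply_eq_fderiv]
  rfl

lemma ae_hess_fourier (h : ∀ f : R3 → ℝ, IsTestFun f → l2Pairing S (hess f) = 0) :
    ∀ᵐ ξ, ∑ i, ∑ j, derivSymbol i ξ * derivSymbol j ξ * (𝓕 (S i j).toComplex : L2C) ξ = 0 := by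
  refine ae_sum_symbol_mul_fourier_eq_zero S (m := fun i j => derivSymbol i * derivSymbol j)
    (fun i j => (IsLocalSymbol.derivSymbol i).mul (.derivSymbol j)) fun φ hφ => ?_
  rw [← h _ (isTestFun_re hφ)]
  congr 1
  ext x i j
  rw [hess, Matrix.of_apply, Matrix.of_apply, partialD_re, partialD_re, symbolOp_mul
    (hasTemperateGrowth_derivSymbol i) (hasTemperateGrowth_derivSymbol j), symbolOp_derivSymbol,
    symbolOp_derivSymbol]

lemma ae_trace_fourier (h : ∀ g : R3 → ℝ, IsTestFun g →
      l2Pairing S (fun x => g x • (1 : Matrix (Fin 3) (Fin 3) ℝ)) = 0) :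
    ∀ᵐ ξ, ∑ i, (𝓕 (S i i).toComplex : L2C) ξ = 0 := by
  have := ae_sum_symbol_mul_fourier_eq_zero S
    (m := fun i j => fun _ => (1 : Matrix (Fin 3) (Fin 3) ℂ) i j)
    (fun i j => IsLocalSymbol.const _) fun φ hφ => by
      rw [← h _ (isTestFun_re hφ)]
      congr 1
      ext x i j
      rw [Matrix.of_apply, symbolOp_const, Matrix.smul_apply, Matrix.one_apply, Matrix.one_apply]
      split_ifs <;> simp
  filter_upwards [this] with ξ hξ
  rw [← hξ]
  simp [Matrix.one_apply]

lemma symbolOp_sum {m : Fin 3 → R3 → ℂ} (hm : ∀ i, (m i).HasTemperateGrowth) (φ : 𝓢(R3, ℂ)) :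
    symbolOp (∑ i, m i) φ = ∑ i, symbolOp (m i) φ := by
  rw [Fin.sum_univ_three, Fin.sum_univ_three, symbolOp_add ((hm 0).add (hm 1)) (hm 2),
    symbolOp_add (hm 0) (hm 1)]

lemma symbolOp_zero (φ : 𝓢(R3, ℂ)) : symbolOp 0 φ = 0 :=
  (symbolOp_const 0 φ).trans (zero_smul _ _)

/-- Polynomial identities between symbols become identities between operators: contraction with d is
the divergence, and the zero diagonal sum is the zero trace. -/
lemma ae_transverseTraceFree_fourier
    (h : ∀ M : R3 → Matrix (Fin 3) (Fin 3) ℝ, IsSymTestField M →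
      (∀ x, (M x).trace = 0) → (∀ x j, matDiv M x j = 0) → l2Pairing S M = 0) (a b : Fin 3) :
    ∀ᵐ ξ, ∑ i, ∑ j, transverseTraceFree (fun k => derivSymbol k ξ) a b i j *
      (𝓕 (S i j).toComplex : L2C) ξ = 0 := by
  have hloc := IsLocalSymbol.transverseTraceFree a b
  have := ae_sum_symbol_mul_fourier_eq_zero S hloc fun φ hφ => by
    refine h _ ⟨fun x => ?_, fun i j => isTestFun_re ((hloc i j).hasCompactSupport φ hφ)⟩
      (fun x => ?_) fun x j => ?_
    · ext i j
      simp [transverseTraceFree_comm _ a b i j]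
    · simp only [Matrix.trace, Matrix.diag, Matrix.of_apply]
      rw [← Complex.re_sum, ← sum_apply, ← symbolOp_sum fun i => (hloc i i).temperate,
        sum_transverseTraceFree_diag, symbolOp_zero]
      simp
    · simp only [matDiv, Matrix.of_apply, partialD_re]
      rw [← Complex.re_sum, ← sum_apply]
      simp only [← symbolOp_derivSymbol]
      simp only [← symbolOp_mul (hasTemperateGrowth_derivSymbol _) (hloc _ _).temperate]
      rw [← symbolOp_sum fun i => (hasTemperateGrowth_derivSymbol i).mul (hloc i j).temperate,
        sum_mul_transverseTraceFree, symbolOp_zero]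
      simp
  simpa only [transverseTraceFree_derivSymbol_apply] using this

end FourierConditions

/-- The sum is bilinear, not Hermitian, so over ℂ it could vanish for a nonzero vector; here it does
not for ξ ≠ 0, the vector being an imaginary multiple of a real one. -/
lemma sum_derivSymbol_mul_self (ξ : R3) :
    ∑ k, derivSymbol k ξ * derivSymbol k ξ = -((2 * Real.pi * ‖ξ‖ : ℝ) : ℂ) ^ 2 := by
  have h := EuclideanSpace.real_norm_sq_eq ξ
  have hI : Complex.I ^ 2 = -1 := Complex.I_sq
  have h2 : ((‖ξ‖ : ℝ) : ℂ) ^ 2 = ∑ i, (ξ i : ℂ) ^ 2 := by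
    exact_mod_cast h
  push_cast
  rw [mul_pow, h2]
  simp only [derivSymbol, Fin.sum_univ_three]
  linear_combination (4 * (Real.pi : ℂ) ^ 2 * ((ξ 0 : ℂ) ^ 2 + (ξ 1 : ℂ) ^ 2 + (ξ 2 : ℂ) ^ 2)) * hI

lemma norm_derivSymbol_le (k : Fin 3) (ξ : R3) : ‖derivSymbol k ξ‖ ≤ 2 * Real.pi * ‖ξ‖ := by
  have h := PiLp.norm_apply_le ξ k
  have hpi := Real.pi_pos
  simp only [derivSymbol, norm_mul, norm_neg, Complex.norm_I, mul_one, Complex.norm_real,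
    Complex.norm_ofNat]
  rw [Real.norm_of_nonneg hpi.le]
  gcongr

/-! ### Derivatives of `(-Δ)^{-1/2} f` on the Fourier side -/

lemma integrable_deriv_invNorm (i : Fin 3) (h : L2C) (φ : 𝓢(R3, ℂ)) :
    Integrable (fun ξ => φ ξ * (derivSymbol i ξ * (((2 * Real.pi * ‖ξ‖)⁻¹ : ℝ) * h ξ))) := by
  have := integrable_pairing (smulLeftCLM ℂ (derivSymbol i) φ) h
  refine this.congr (Filter.Eventually.of_forall fun ξ => ?_)
  simp only [smulLeftCLM_apply_apply (hasTemperateGrowth_derivSymbol i), smul_eq_mul]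
  ring

lemma invSqrtLaplacian_apply_lineDerivOp_fourier (f : L2) (i : Fin 3) (ψ : 𝓢(R3, ℂ)) :
    invSqrtLaplacian f (∂_{stdVec i} (𝓕 ψ)) = ∫ ξ, ψ ξ * (derivSymbol i ξ *
      (((2 * Real.pi * ‖ξ‖)⁻¹ : ℝ) * (𝓕 f.toComplex : L2C) ξ)) := by
  rw [invSqrtLaplacian, TemperedDistribution.fourierInv_apply, ← symbolOp_derivSymbol,
    symbolOp_apply, fourierInv_fourier_eq, fourierInv_fourier_eq, invNormMul_apply]
  refine integral_congr_ae (Filter.Eventually.of_forall fun ξ => ?_)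
  simp only [smulLeftCLM_apply_apply (hasTemperateGrowth_derivSymbol i), smul_eq_mul]
  ring

/-- The weight (2π|ξ|)⁻¹ is a common scalar factor of the three components, so it does not affect
the vanishing of the divergence. -/
lemma mem_L2df_of_ae {u : Fin 3 → L2}
    (h : ∀ᵐ ξ, ∑ i, derivSymbol i ξ * (𝓕 (u i).toComplex : L2C) ξ = 0) : u ∈ L2df := by
  change ∑ i, ∂_{stdVec i} (invSqrtLaplacian (u i)) = 0
  ext φ
  obtain ⟨ψ, rfl⟩ : ∃ ψ : 𝓢(R3, ℂ), 𝓕 ψ = φ := ⟨𝓕⁻ φ, fourier_fourierInv_eq φ⟩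
  have h0 : (0 : 𝓢'(R3, ℂ)) (𝓕 ψ) = 0 := rfl
  have h2 : (∑ i, ∂_{stdVec i} (invSqrtLaplacian (u i))) (𝓕 ψ) =
      ∑ i, (∂_{stdVec i} (invSqrtLaplacian (u i))) (𝓕 ψ) := by
    simp [Fin.sum_univ_three]
    ring
  rw [h2, h0]
  simp only [TemperedDistribution.lineDerivOp_apply_apply, map_neg,
    invSqrtLaplacian_apply_lineDerivOp_fourier, Finset.sum_neg_distrib, neg_eq_zero]
  rw [← integral_finsetSum _ fun i _ => integrable_deriv_invNorm i _ ψ]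
  refine integral_eq_zero_of_ae ?_
  filter_upwards [h] with ξ hξ
  have : ∀ i, ψ ξ * (derivSymbol i ξ * (((2 * Real.pi * ‖ξ‖)⁻¹ : ℝ) *
      (𝓕 (u i).toComplex : L2C) ξ)) = ψ ξ * ((2 * Real.pi * ‖ξ‖)⁻¹ : ℝ) *
      (derivSymbol i ξ * (𝓕 (u i).toComplex : L2C) ξ) := fun i => by ring
  simp only [this, ← Finset.mul_sum, hξ, mul_zero, Pi.zero_apply]

/-- The sign of -1/2 comes from transposing the derivative onto the test function, whose symbol is
-2πiξ. -/
lemma toDistribution_eq_symGrad_of_ae {f : L2} {u : Fin 3 → L2} {i j : Fin 3}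
    (h : ∀ᵐ ξ, (𝓕 f.toComplex : L2C) ξ = -(1 / 2 : ℂ) * ((2 * Real.pi * ‖ξ‖)⁻¹ : ℝ) *
      (derivSymbol i ξ * (𝓕 (u j).toComplex : L2C) ξ +
        derivSymbol j ξ * (𝓕 (u i).toComplex : L2C) ξ)) :
    f.toDistribution = symGrad (fun k => invSqrtLaplacian (u k)) i j := by
  ext φ
  obtain ⟨ψ, rfl⟩ : ∃ ψ : 𝓢(R3, ℂ), 𝓕 ψ = φ := ⟨𝓕⁻ φ, fourier_fourierInv_eq φ⟩
  rw [symGrad_apply, L2.toDistribution_fourier_apply,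
    invSqrtLaplacian_apply_lineDerivOp_fourier, invSqrtLaplacian_apply_lineDerivOp_fourier,
    ← integral_add (integrable_deriv_invNorm i _ ψ) (integrable_deriv_invNorm j _ ψ),
    ← integral_const_mul]
  refine integral_congr_ae ?_
  filter_upwards [h] with ξ hξ
  rw [hξ]
  ring

/-! ### Construction of the velocity -/

section Velocity

open ComplexConjugate

/-- For a matrix `S` of real square integrable functions there is a real field `u` with
`𝓕 uⱼ = (π|ξ|)⁻¹ ∑ₖ (-2πi ξₖ) 𝓕 Sₖⱼ`. -/
lemma exists_velocity (S : Matrix (Fin 3) (Fin 3) L2) : ∃ u : Fin 3 → L2, ∀ j, ∀ᵐ ξ,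
    (𝓕 (u j).toComplex : L2C) ξ = ((Real.pi * ‖ξ‖)⁻¹ : ℝ) *
      ∑ k, derivSymbol k ξ * (𝓕 (S k j).toComplex : L2C) ξ := by
  have hmem : ∀ j, MemLp (fun ξ => (((Real.pi * ‖ξ‖)⁻¹ : ℝ) : ℂ) *
      ∑ k, derivSymbol k ξ * (𝓕 (S k j).toComplex : L2C) ξ) 2 volume := by
    intro j
    simp only [Finset.mul_sum]
    refine memLp_finsetSum _ fun k _ => ?_
    -- The multiplier is bounded by 2π|ξ| / (π|ξ|) = 2.
    refine MemLp.of_le_mul (c := 2) (Lp.memLp (𝓕 (S k j).toComplex : L2C)) ?_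
      (Filter.Eventually.of_forall fun ξ => ?_)
    · refine AEStronglyMeasurable.mul ?_ (AEStronglyMeasurable.mul ?_ (Lp.aestronglyMeasurable _))
      · apply Measurable.aestronglyMeasurable
        fun_prop
      · exact (hasTemperateGrowth_derivSymbol k).1.continuous.aestronglyMeasurable
    · rw [← mul_assoc, norm_mul, norm_mul]
      gcongr
      have hpi := Real.pi_pos
      rw [Complex.norm_real, Real.norm_of_nonneg (by positivity)]
      rcases eq_or_ne ξ 0 with rfl | hξ
      · simp
      · have : 0 < ‖ξ‖ := norm_pos_iff.2 hξ
        rw [inv_mul_le_iff₀ (by positivity)]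
        linarith [norm_derivSymbol_le k ξ]
  have hu : ∀ j, ∃ u : L2, 𝓕 u.toComplex = (hmem j).toLp := by
    intro j
    refine exists_fourier_toComplex_eq _ ?_
    have hw := (hmem j).coeFn_toLp
    have hw' := (Measure.measurePreserving_neg (volume : Measure R3)).quasiMeasurePreserving.ae hw
    filter_upwards [hw, hw', ae_all_iff.2 fun k => ae_conj_fourier_toComplex (S k j)]
      with ξ h1 h2 h3
    -- The weight is real and even, and -2πiξ is unchanged by conjugation combined with ξ ↦ -ξ, so
    -- Hermitian symmetry passes from S to the velocity.
    rw [h1, h2, map_mul, map_sum, Complex.conj_ofReal, norm_neg]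
    congr 1
    refine Finset.sum_congr rfl fun k _ => ?_
    rw [map_mul, h3 k]
    simp [derivSymbol, map_ofNat]
  choose u hu using hu
  refine ⟨u, fun j => ?_⟩
  rw [hu j]
  exact (hmem j).coeFn_toLp

end Velocity

end

/-! ### Characterization of strain matrices by orthogonality -/

theorem mainTheorem4 (S : Matrix (Fin 3) (Fin 3) L2) (hS : S ∈ L2Sym) :
    S ∈ L2st ↔
      (∀ f : R3 → ℝ, IsTestFun f → l2Pairing S (hess f) = 0) ∧
      (∀ g : R3 → ℝ, IsTestFun g →
        l2Pairing S (fun x => g x • (1 : Matrix (Fin 3) (Fin 3) ℝ)) = 0) ∧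
      (∀ M : R3 → Matrix (Fin 3) (Fin 3) ℝ, IsSymTestField M →
        (∀ x, (M x).trace = 0) → (∀ x j, matDiv M x j = 0) → l2Pairing S M = 0) := by
  constructor
  · intro h
    obtain ⟨h1, h2, h3⟩ := l2Pairing_eq_zero_of_mem_L2st h
    exact ⟨h1, h2, fun M hM _ hdiv => h3 M hM hdiv⟩
  rintro ⟨h1, h2, h3⟩
  -- The factor (π|ξ|)⁻¹ is forced: times the -½(2π|ξ|)⁻¹ of the symmetric gradient it equals
  -- -(2π|ξ|)⁻², the inverse of d·d.
  obtain ⟨u, hu⟩ := exists_velocity S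
  have e1 := ae_hess_fourier h1
  have e2 := ae_trace_fourier h2
  have e3 := ae_all_iff.2 fun a => ae_all_iff.2 fun b => ae_transverseTraceFree_fourier h3 a b
  have hu' := ae_all_iff.2 hu
  refine ⟨hS, u, mem_L2df_of_ae ?_, fun i j => toDistribution_eq_symGrad_of_ae ?_⟩
  -- Up to the weight, d·û is the quadratic form of the transform of S at d, which the Hessian
  -- condition kills.
  · filter_upwards [e1, hu'] with ξ h1 hu
    have : ∀ i, derivSymbol i ξ * (𝓕 (u i).toComplex : L2C) ξ = ((Real.pi * ‖ξ‖)⁻¹ : ℝ) *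
        ∑ k, derivSymbol k ξ * derivSymbol i ξ * (𝓕 (S k i).toComplex : L2C) ξ := fun i => by
      rw [hu i, mul_left_comm, Finset.mul_sum]
      congr 1
      exact Finset.sum_congr rfl fun k _ => by ring
    simp only [this, ← Finset.mul_sum]
    rw [Finset.sum_comm, h1, mul_zero]
  -- Recovering the matrix divides by d·d, which vanishes only at the origin, a null set.
  · have hne : ∀ᵐ ξ : R3, ξ ≠ 0 := compl_mem_ae_iff.2 (measure_singleton 0)
    filter_upwards [e1, e2, e3, hu', hne] with ξ h1 h2 h3 hu hξ
    have hpi : (Real.pi : ℂ) ≠ 0 := Complex.ofReal_ne_zero.2 Real.pi_ne_zero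
    have hn : ((‖ξ‖ : ℝ) : ℂ) ≠ 0 := Complex.ofReal_ne_zero.2 (norm_ne_zero_iff.2 hξ)
    have hs := sum_derivSymbol_mul_self ξ
    have hs0 : ∑ k, derivSymbol k ξ * derivSymbol k ξ ≠ 0 := by
      rw [hs]
      push_cast
      simp [hpi, hn]
    have hsym : ∀ i j, (𝓕 (S i j).toComplex : L2C) ξ = (𝓕 (S j i).toComplex : L2C) ξ :=
      fun i j => by rw [show S i j = S j i from (hS.apply i j).symm]
    have key := sum_mul_self_mul_eq_of_orthogonal (d := fun k => derivSymbol k ξ)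
      (H := fun i j => (𝓕 (S i j).toComplex : L2C) ξ) hs0 hsym h1 h2 h3 i j
    simp only [hs] at key
    rw [hu i, hu j]
    push_cast at key ⊢
    field_simp
    linear_combination -key
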